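/- Let $D$ be a finite directed graph, without loops and without parallel arcs (both arcs $(u,v)$ and $(v,u)$ may be present for distinct vertices $u,v$), of even order $n$, and let $\delta(D)$ be the minimum, over all vertices $v$ of $D$, of the smaller of the outdegree and the indegree of $v$. If $\delta(D) > \frac{24}{46}n$, then $D$ contains an anti-directed 2-factor, that is, a collection of vertex-disjoint anti-directed cycles in $D$ that together span the vertex set of $D$. Here an anti-directed cycle in $D$ is a cycle in the multigraph underlying $D$ (obtained by ignoring the directions of the arcs) such that no pair of consecutive arcs of the cycle forms a directed path in $D$ (that is, the head of neither of the two arcs is the tail of the other). -/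

import Mathlib

namespace Digraph

variable {V : Type*} (D : Digraph V)

/-- A directed graph in the usual strict sense: no arc joins a vertex to itself. (Parallel arcs do
not exist in a `Digraph`; both arcs `(u, v)` and `(v, u)` may be present.) -/
def Loopless : Prop := ∀ v, ¬ D.Adj v v

/-- The outdegree of `v`: the number of arcs of `D` directed out of `v`. -/
noncomputable def outDeg (v : V) : ℕ := {w | D.Adj v w}.ncard

/-- The indegree of `v`: the number of arcs of `D` directed into `v`. -/
noncomputable def inDeg (v : V) : ℕ := {w | D.Adj w v}.ncard

/-- `δ(D)`, the minimum over all vertices of the smaller of the outdegree and the indegree. -/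
noncomputable def minSemidegree : ℕ := ⨅ v, min (D.outDeg v) (D.inDeg v)

/-- A cycle in the multigraph underlying `D`: a cyclic sequence of `len ≥ 2` distinct vertices and
distinct arcs of `D`, in which the `i`-th arc, in one of its two directions, joins the `i`-th vertex
to the next one. An arc is the pair (tail, head). A cycle of length `2` consists of the two
opposite arcs between two vertices. -/
structure UnderlyingCycle where
  len : ℕ
  two_le_len : 2 ≤ len
  vert : ZMod len → V
  vert_injective : Function.Injective vert
  arc : ZMod len → V × V
  arc_injective : Function.Injective arc
  arc_mem : ∀ i, D.Adj (arc i).1 (arc i).2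
  arc_joins : ∀ i, arc i = (vert i, vert (i + 1)) ∨ arc i = (vert (i + 1), vert i)

variable {D}

/-- The set of vertices of the cycle. -/
def UnderlyingCycle.verts (C : D.UnderlyingCycle) : Set V := Set.range C.vert

/-- Two arcs, taken in one of the two orders, form a directed path: the head of one of them is the
tail of the other. -/
def FormDirectedPath (a b : V × V) : Prop := a.2 = b.1 ∨ b.2 = a.1

/-- An anti-directed cycle: no two consecutive arcs form a directed path. -/
def UnderlyingCycle.IsAntidirected (C : D.UnderlyingCycle) : Prop :=
  ∀ i, ¬ FormDirectedPath (C.arc i) (C.arc (i + 1))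

variable (D)

/-- `D` has an anti-directed 2-factor: a collection of pairwise vertex-disjoint anti-directed cycles
in `D` that together cover all vertices. -/
def HasAntidirectedTwoFactor : Prop :=
  ∃ S : Set D.UnderlyingCycle, (∀ C ∈ S, C.IsAntidirected) ∧
    S.PairwiseDisjoint UnderlyingCycle.verts ∧ (⋃ C ∈ S, C.verts) = Set.univ

end Digraph

/-!
Let `n = 2 * m` be the order of `D`. For a set `X` of `m` vertices let `B` be the bipartite graph
with sides `X` and `Xᶜ` whose edges are the arcs from `X` to `Xᶜ`. A `2`-factor of `B` is an
anti-directed `2`-factor of `D`: it splits into two disjoint perfect matchings, and the permutation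
of the vertices that follows one of them from `X` to `Xᶜ` and the other one back has the required
cycles as orbits (`exists_disjoint_matchings_of_two_regular`, `hasAntidirectedTwoFactor_of_perm`).
So it suffices to find an `X` for which `B` has a `2`-factor.

By Hall's theorem, `B` has a `2`-factor unless there are `S ⊆ X` and `T ⊆ Xᶜ` with
`|S| + |T| = m + k`, `k ≥ 1`, and at most `2 * k - 1` edges between them
(`exists_two_regular_subgraph`). In a smallest such pair every vertex of `S` has degree at most
`m - |T| + 1` in `B`, with equality at most `2 * k - 1` times, and likewise for `T`. The weights
`degreeWeight m h` are chosen such that the vertices of such a pair always have total weight at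
least `1`, a vertex of degree `h` in `B` having weight `degreeWeight m h`
(`one_le_violatorWeight_add`). They are about `1 / (h + 1)` for `h < m / 2` and vanish beyond.

If `X` is random, the degree of a vertex in `B` is hypergeometric, so the expected total weight is
at most `2 * m * 𝔼[degreeWeight m H]`, where `H` counts the marked elements in a random `m`-subset
of `2 * m - 1` elements of which `m + 1 + m / 23` are marked: that number is a lower bound for the
semidegrees of `D`. The theorem follows once this is less than `1`
(`hypergeometricSum_degreeWeight_lt`). Consecutive terms of the distribution have a simple ratio,
so sums of its terms are evaluated by Horner's scheme. For `m < 368` this is done numerically; the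
margin is below one percent at `m = 21`. For `m ≥ 368` the ratios are bounded uniformly: the
terms below `m / 2` are dominated by a geometric series with ratio `21 / 25`, and so amount to
little more than `25 / 4` times the term next to `m / 2`, whose weight is about `2 / m`, while the
terms above add up to at least `25` times that term.
-/

/-! ### Anti-directed cycles from a permutation -/

namespace Digraph

/-- The orbit of `v` under a permutation `τ` of a finite set, parametrised by `ZMod n` so that
`τ` becomes the shift. -/
theorem exists_zmod_param_orbit {V : Type*} [Finite V] (τ : Equiv.Perm V) (v : V) :
    ∃ (n : ℕ) (c : ZMod n → V), n ≠ 0 ∧ Function.Injective c ∧ (∀ i, c (i + 1) = τ (c i)) ∧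
      Set.range c = MulAction.orbit (Subgroup.zpowers τ) v := by
  refine ⟨Function.minimalPeriod (τ • ·) v,
    fun k => ((MulAction.orbitZPowersEquiv τ v).symm k : V), ?_, ?_, ?_, ?_⟩
  · exact (MulAction.minimalPeriod_pos τ v).out
  · exact Subtype.val_injective.comp (Equiv.injective _)
  · intro i
    obtain ⟨j, rfl⟩ := ZMod.intCast_surjective i
    have h1 := MulAction.orbitZPowersEquiv_symm_apply' τ v j
    have h2 := MulAction.orbitZPowersEquiv_symm_apply' τ v (1 + j)
    rw [Int.cast_add, Int.cast_one, add_comm] at h2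
    dsimp only
    rw [h1, h2, zpow_add, mul_smul, zpow_one]
    rfl
  · ext w
    constructor
    · rintro ⟨k, rfl⟩
      exact Subtype.prop _
    · intro hw
      exact ⟨MulAction.orbitZPowersEquiv τ v ⟨w, hw⟩, by simp⟩

variable {V : Type*} {D : Digraph V}

/-- If `τ` swaps `X` and its complement, every `v ∈ X` sends an arc to `τ v` and every `v ∉ X`
receives one from `τ v`, then the orbits of `τ` are anti-directed cycles, unless they have only
two elements. -/
theorem hasAntidirectedTwoFactor_of_perm [Finite V] (X : Set V) (τ : Equiv.Perm V)
    (hX : ∀ v ∈ X, τ v ∉ X ∧ D.Adj v (τ v)) (hY : ∀ v ∉ X, τ v ∈ X ∧ D.Adj (τ v) v)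
    (hτ : ∀ v, τ (τ v) ≠ v) : D.HasAntidirectedTwoFactor := by
  classical
  have alt : ∀ v, τ v ∈ X ↔ v ∉ X := fun v =>
    ⟨fun h hv => (hX v hv).1 h, fun h => (hY v h).1⟩
  have key : ∀ v, ∃ C : D.UnderlyingCycle, C.IsAntidirected ∧
      C.verts = MulAction.orbit (Subgroup.zpowers τ) v := by
    intro v
    obtain ⟨n, c, hn, hc, hs, hr⟩ := exists_zmod_param_orbit τ v
    have hne : ∀ i, c (i + 1) ≠ c i := by
      intro i h
      have := alt (c i)
      rw [← hs, h] at this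
      tauto
    have hn2 : 2 ≤ n := by
      by_contra hlt
      obtain rfl : n = 1 := by omega
      exact hne 0 (congrArg c (Subsingleton.elim _ _))
    refine ⟨{ len := n
              two_le_len := hn2
              vert := c
              vert_injective := hc
              arc := fun i => if c i ∈ X then (c i, c (i + 1)) else (c (i + 1), c i)
              arc_injective := ?_
              arc_mem := ?_
              arc_joins := ?_ }, ?_, hr⟩
    · have two : ∀ i j, c i = c (j + 1) → c (i + 1) ≠ c j := by
        intro i j h1 h2
        rw [hs, h1, hs] at h2
        exact hτ _ h2
      intro i j hij
      dsimp only at hij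
      split_ifs at hij with hi hj hj <;> rw [Prod.mk.injEq] at hij
      · exact hc hij.1
      · exact absurd hij.2 (two i j hij.1)
      · exact absurd hij.1 (two i j hij.2)
      · exact hc hij.2
    · intro i
      split_ifs with hi
      · rw [hs]
        exact (hX _ hi).2
      · rw [hs]
        exact (hY _ hi).2
    · intro i
      split_ifs
      · exact Or.inl rfl
      · exact Or.inr rfl
    · intro i
      have h1 : c (i + 1) ∈ X ↔ c i ∉ X := by rw [hs]; exact alt _
      have h2 := hne i
      have h3 := hne (i + 1)
      by_cases hi : c i ∈ X
      · have hi' : c (i + 1) ∉ X := fun h => h1.1 h hi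
        simp only [FormDirectedPath, hi, hi', if_true, if_false]
        rintro (h | h)
        · exact h3 h.symm
        · exact h2 h
      · have hi' : c (i + 1) ∈ X := h1.2 hi
        simp only [FormDirectedPath, hi, hi', if_true, if_false]
        rintro (h | h)
        · exact h2 h.symm
        · exact h3 h
  choose C hC hCv using key
  refine ⟨Set.range fun q : MulAction.orbitRel.Quotient (Subgroup.zpowers τ) V => C q.out,
    ?_, ?_, ?_⟩
  · rintro _ ⟨q, rfl⟩
    exact hC _
  · rintro _ ⟨q, rfl⟩ _ ⟨q', rfl⟩ hne
    rw [Function.onFun, hCv, hCv, Set.disjoint_left]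
    intro w hw hw'
    apply hne
    have h1 := MulAction.orbit_eq_iff.2 hw
    have h2 := MulAction.orbit_eq_iff.2 hw'
    have : q.out ∈ MulAction.orbit (Subgroup.zpowers τ) q'.out := by
      rw [← MulAction.orbit_eq_iff, ← h1, ← h2]
    have h3 : (Quotient.mk'' q.out : MulAction.orbitRel.Quotient (Subgroup.zpowers τ) V)
        = Quotient.mk'' q'.out := Quotient.sound' this
    rw [Quotient.out_eq', Quotient.out_eq'] at h3
    rw [h3]
  · rw [Set.eq_univ_iff_forall]
    intro w
    simp only [Set.mem_iUnion]
    refine ⟨_, ⟨Quotient.mk'' w, rfl⟩, ?_⟩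
    rw [hCv]
    have h : (Quotient.mk'' w : MulAction.orbitRel.Quotient (Subgroup.zpowers τ) V).out ∈
        MulAction.orbit (Subgroup.zpowers τ) w := 
      MulAction.orbitRel_apply.1 (@Quotient.mk_out _ (MulAction.orbitRel _ _) w)
    exact MulAction.mem_orbit_symm.1 h
end Digraph

/-! ### Two-factors of bipartite graphs -/

open Finset

/-- The criterion for a bipartite graph with equal sides to have a `2`-factor, a case of Ore's
`f`-factor theorem. -/
theorem exists_two_regular_subgraph {α β : Type*} [Fintype α] [Fintype β] (E : α → β → Prop)
    [DecidableRel E] (hcard : Fintype.card α = Fintype.card β)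
    (h : ∀ (S : Finset α) (T : Finset β),
      2 * (#S + #T) ≤ 2 * Fintype.card α + #{p ∈ S ×ˢ T | E p.1 p.2}) :
    ∃ F : α → β → Prop, (∀ a b, F a b → E a b) ∧ (∀ a, {b | F a b}.ncard = 2) ∧
      ∀ b, {a | F a b}.ncard = 2 := by
  classical
  -- Each vertex is doubled, and each pair `p` is subdivided by two vertices, one on each side.
  -- A perfect matching of this graph pairs the two subdividing vertices of `p` exactly when the
  -- edge `p` is left out of the `2`-factor.
  let t : (α × Bool) ⊕ (α × β) → Finset ((β × Bool) ⊕ (α × β)) := fun x => match x with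
    | .inl (a, _) => {y | ∃ b, E a b ∧ y = .inr (a, b)}
    | .inr p => {y | y = .inr p ∨ E p.1 p.2 ∧ ∃ i, y = .inl (p.2, i)}
  have hall : ∀ A : Finset ((α × Bool) ⊕ (α × β)), #A ≤ #(A.biUnion t) := by
    intro A
    let A₁ : Finset α := {a | ∃ i, Sum.inl (a, i) ∈ A}
    let Q : Finset (α × β) := {p | Sum.inr p ∈ A}
    let T : Finset β := {b | ∃ a, (a, b) ∈ Q ∧ E a b}
    have hA : #A ≤ 2 * #A₁ + #Q := by
      have hsub : A ⊆ (A₁ ×ˢ (univ : Finset Bool)).disjSum Q := by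
        rintro (⟨a, i⟩ | p) hx
        · simp only [inl_mem_disjSum, mem_product, mem_univ, and_true, A₁, mem_filter, true_and]
          exact ⟨i, hx⟩
        · simpa [Q] using hx
      have := card_le_card hsub
      rw [card_disjSum, card_product, card_univ, Fintype.card_bool] at this
      omega
    have hN : (T ×ˢ (univ : Finset Bool)).disjSum (Q ∪ {p ∈ A₁ ×ˢ Tᶜ | E p.1 p.2}) ⊆
        A.biUnion t := by
      rintro (⟨b, i⟩ | ⟨a, b⟩) hx
      · simp only [inl_mem_disjSum, mem_product, mem_univ, and_true, T, mem_filter,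
          true_and] at hx
        obtain ⟨a, hab, hE⟩ := hx
        rw [mem_biUnion]
        refine ⟨.inr (a, b), (mem_filter.1 hab).2, ?_⟩
        simp [t, hE]
      · simp only [inr_mem_disjSum, mem_union, mem_filter, mem_product] at hx
        rw [mem_biUnion]
        rcases hx with hx | ⟨⟨ha, -⟩, hE⟩
        · exact ⟨.inr (a, b), (mem_filter.1 hx).2, by simp [t]⟩
        · obtain ⟨i, hi⟩ := (mem_filter.1 ha).2
          exact ⟨.inl (a, i), hi, by simp [t, hE]⟩
    have hdisj : Disjoint Q {p ∈ A₁ ×ˢ Tᶜ | E p.1 p.2} := by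
      rw [disjoint_left]
      rintro ⟨a, b⟩ hq hp
      simp only [mem_filter, mem_product, mem_compl] at hp
      refine hp.1.2 ?_
      simp only [T, mem_filter, mem_univ, true_and]
      exact ⟨a, hq, hp.2⟩
    have h1 := card_le_card hN
    rw [card_disjSum, card_product, card_univ, Fintype.card_bool, card_union_of_disjoint hdisj]
      at h1
    have h2 := h A₁ Tᶜ
    have h3 : #T + #Tᶜ = Fintype.card β := card_add_card_compl T
    omega
  obtain ⟨f, hf, hft⟩ := (all_card_le_biUnion_card_iff_exists_injective t).1 hall
  have hbij : Function.Bijective f := by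
    rw [Fintype.bijective_iff_injective_and_card]
    refine ⟨hf, ?_⟩
    simp [hcard]
  have hl : ∀ a i, ∃ b, E a b ∧ f (.inl (a, i)) = .inr (a, b) := by
    intro a i
    simpa [t] using hft (.inl (a, i))
  have hr : ∀ a b, f (.inr (a, b)) = .inr (a, b) ∨
      E a b ∧ ∃ i, f (.inr (a, b)) = .inl (b, i) := by
    intro a b
    simpa [t] using hft (.inr (a, b))
  refine ⟨fun a b => f (.inr (a, b)) ≠ .inr (a, b), ?_, ?_, ?_⟩
  · intro a b hab
    exact ((hr a b).resolve_left hab).1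
  · intro a
    choose c hcE hc using hl a
    rw [Set.ncard_eq_two]
    refine ⟨c false, c true, ?_, ?_⟩
    · intro heq
      have : f (.inl (a, false)) = f (.inl (a, true)) := by rw [hc, hc, heq]
      simpa using hf this
    · ext b
      simp only [Set.mem_ofPred_eq, Set.mem_insert_iff, Set.mem_singleton_iff]
      constructor
      · intro hb
        obtain ⟨x, hx⟩ := hbij.2 (.inr (a, b))
        rcases x with ⟨a', i⟩ | ⟨a', b'⟩
        · obtain ⟨b', -, hb'⟩ := hl a' i
          rw [hb'] at hx
          obtain ⟨rfl, rfl⟩ : a' = a ∧ b' = b := by simpa using hx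
          rw [hc] at hb'
          have : c i = b' := by simpa using hb'
          cases i <;> simp [← this]
        · rcases hr a' b' with h' | ⟨-, i, h'⟩
          · obtain ⟨rfl, rfl⟩ : a' = a ∧ b' = b := by simpa [h'] using hx
            exact absurd h' hb
          · simp [h'] at hx
      · have : ∀ i, f (.inr (a, c i)) ≠ .inr (a, c i) := by
          intro i heq
          have := hf (heq.trans (hc i).symm)
          simp at this
        rintro (rfl | rfl) <;> exact this _
  · intro b
    have hs : ∀ i, ∃ a, f (.inr (a, b)) = .inl (b, i) := by
      intro i
      obtain ⟨x, hx⟩ := hbij.2 (.inl (b, i))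
      rcases x with ⟨a', j⟩ | ⟨a', b'⟩
      · obtain ⟨b', -, hb'⟩ := hl a' j
        simp [hb'] at hx
      · rcases hr a' b' with h' | ⟨-, j, h'⟩
        · simp [h'] at hx
        · obtain ⟨rfl, rfl⟩ : b' = b ∧ j = i := by simpa [h'] using hx
          exact ⟨a', h'⟩
    choose c hc using hs
    rw [Set.ncard_eq_two]
    refine ⟨c false, c true, ?_, ?_⟩
    · intro heq
      have h1 := hc false
      rw [heq, hc] at h1
      simp at h1
    · ext a
      simp only [Set.mem_ofPred_eq, Set.mem_insert_iff, Set.mem_singleton_iff]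
      constructor
      · intro ha
        obtain ⟨-, i, hi⟩ := (hr a b).resolve_left ha
        have := hf (hi.trans (hc i).symm)
        have : a = c i := by simpa using this
        cases i <;> simp [this]
      · have : ∀ i, f (.inr (c i, b)) ≠ .inr (c i, b) := by
          intro i
          simp [hc]
        rintro (rfl | rfl) <;> exact this _

/-- A `2`-regular bipartite graph is the union of two disjoint perfect matchings. -/
theorem exists_disjoint_matchings_of_two_regular {α β : Type*} [Fintype α] [Fintype β]
    (F : α → β → Prop) (hα : ∀ a, {b | F a b}.ncard = 2) (hβ : ∀ b, {a | F a b}.ncard = 2) :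
    ∃ f g : α ≃ β, ∀ a, F a (f a) ∧ F a (g a) ∧ f a ≠ g a := by
  classical
  have hα' : ∀ a, #{b | F a b} = 2 := fun a => by
    rw [← hα a, Set.ncard_eq_toFinset_card']; congr 1; ext; simp
  have hβ' : ∀ b, #{a | F a b} = 2 := fun b => by
    rw [← hβ b, Set.ncard_eq_toFinset_card']; congr 1; ext; simp
  have hcard : Fintype.card α = Fintype.card β := by
    have := card_mul_eq_card_mul F (s := univ) (t := univ) (m := 2) (n := 2)
      (fun a _ => hα' a) (fun b _ => hβ' b)
    simpa using this
  obtain ⟨f, hf, hfF⟩ := (all_card_le_biUnion_card_iff_exists_injective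
    (fun a => ({b | F a b} : Finset β))).1 (fun S => by
      have := card_mul_le_card_mul F (s := S) (t := S.biUnion fun a => {b | F a b})
        (m := 2) (n := 2) (fun a ha => ?_) (fun b _ => ?_)
      · omega
      · rw [← hα' a]
        refine card_le_card fun b hb => ?_
        rw [mem_bipartiteAbove]
        exact ⟨mem_biUnion.2 ⟨a, ha, hb⟩, (mem_filter.1 hb).2⟩
      · rw [← hβ' b]
        refine card_le_card fun a ha => ?_
        rw [mem_bipartiteBelow] at ha
        simpa using ha.2)
  simp only [mem_filter, mem_univ, true_and] at hfF
  have hother : ∀ a, ∃ b, b ≠ f a ∧ F a b := by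
    intro a
    obtain ⟨b, hb, hne⟩ := exists_mem_ne (by rw [hα' a]; omega : 1 < #{b | F a b}) (f a)
    exact ⟨b, hne, (mem_filter.1 hb).2⟩
  choose g hgf hgF using hother
  have hfb : Function.Bijective f := (Fintype.bijective_iff_injective_and_card f).2 ⟨hf, hcard⟩
  have hg : Function.Injective g := by
    -- `g a = g a' = f c` would give `g a` the three neighbours `a`, `a'` and `c`.
    intro a a' haa
    by_contra hne
    obtain ⟨c, hc⟩ := hfb.2 (g a)
    have h3 : ({a, a', c} : Finset α) ⊆ ({x | F x (g a)} : Finset α) := by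
      intro x hx
      simp only [mem_insert, mem_singleton] at hx
      simp only [mem_filter, mem_univ, true_and]
      rcases hx with rfl | rfl | rfl
      · exact hgF _
      · rw [haa]; exact hgF _
      · rw [← hc]; exact hfF _
    have h4 := card_le_card h3
    rw [hβ', card_eq_three.2 ⟨a, a', c, hne, ?_, ?_, rfl⟩] at h4
    · omega
    · rintro rfl
      exact hgf a hc.symm
    · rintro rfl
      exact hgf a' (haa.symm.trans hc.symm)
  exact ⟨Equiv.ofBijective f hfb,
    Equiv.ofBijective g ((Fintype.bijective_iff_injective_and_card g).2 ⟨hg, hcard⟩),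
    fun a => ⟨hfF a, hgF a, (hgf a).symm⟩⟩

/-! ### Weights and violators of the criterion -/

/-- Among the pairs `(S, T)` violating the `2`-factor criterion, one of least size has at most one
edge at each vertex between `S` and `T`, since deleting a vertex with two such edges would keep the
violation. -/
theorem exists_minimal_violator {α β : Type*} [Fintype α] [Fintype β] (E : α → β → Prop)
    [DecidableRel E] (N : ℕ)
    (h : ∃ (S : Finset α) (T : Finset β), N + #{p ∈ S ×ˢ T | E p.1 p.2} < 2 * (#S + #T)) :
    ∃ (S : Finset α) (T : Finset β), N + #{p ∈ S ×ˢ T | E p.1 p.2} < 2 * (#S + #T) ∧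
      (∀ a ∈ S, #{b ∈ T | E a b} ≤ 1) ∧ ∀ b ∈ T, #{a ∈ S | E a b} ≤ 1 := by
  classical
  have h' : ∃ n, ∃ (S : Finset α) (T : Finset β), #S + #T = n ∧
      N + #{p ∈ S ×ˢ T | E p.1 p.2} < 2 * (#S + #T) := by
    obtain ⟨S, T, hST⟩ := h
    exact ⟨_, S, T, rfl, hST⟩
  obtain ⟨S, T, hn, hST⟩ := Nat.find_spec h'
  have hmin : ∀ (S' : Finset α) (T' : Finset β), #S' + #T' < #S + #T →
      2 * (#S' + #T') ≤ N + #{p ∈ S' ×ˢ T' | E p.1 p.2} := by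
    intro S' T' hlt
    by_contra hcon
    exact Nat.find_min h' (hn ▸ hlt) ⟨S', T', rfl, not_le.1 hcon⟩
  refine ⟨S, T, hST, fun a ha => ?_, fun b hb => ?_⟩
  · by_contra! hdeg
    have hS := card_erase_add_one ha
    have h1 := hmin (S.erase a) T (by omega)
    have h2 : #{p ∈ S.erase a ×ˢ T | E p.1 p.2} + #{b ∈ T | E a b} ≤
        #{p ∈ S ×ˢ T | E p.1 p.2} := by
      rw [← card_map (Function.Embedding.sectR a β), ← card_union_of_disjoint]
      · refine card_le_card fun p hp => ?_
        simp only [mem_union, mem_filter, mem_product, mem_erase, mem_map,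
          Function.Embedding.sectR_apply] at hp ⊢
        rcases hp with hp | ⟨b, hb, rfl⟩
        · tauto
        · exact ⟨⟨ha, hb.1⟩, hb.2⟩
      · rw [disjoint_left]
        intro p hp hp'
        simp only [mem_filter, mem_product, mem_erase, mem_map,
          Function.Embedding.sectR_apply] at hp hp'
        obtain ⟨b, -, rfl⟩ := hp'
        exact hp.1.1.1 rfl
    omega
  · by_contra! hdeg
    have hT := card_erase_add_one hb
    have h1 := hmin S (T.erase b) (by omega)
    have h2 : #{p ∈ S ×ˢ T.erase b | E p.1 p.2} + #{a ∈ S | E a b} ≤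
        #{p ∈ S ×ˢ T | E p.1 p.2} := by
      rw [← card_map (Function.Embedding.sectL α b), ← card_union_of_disjoint]
      · refine card_le_card fun p hp => ?_
        simp only [mem_union, mem_filter, mem_product, mem_erase, mem_map,
          Function.Embedding.sectL_apply] at hp ⊢
        rcases hp with hp | ⟨a, ha, rfl⟩
        · tauto
        · exact ⟨⟨ha.1, hb⟩, ha.2⟩
      · rw [disjoint_left]
        intro p hp hp'
        simp only [mem_filter, mem_product, mem_erase, mem_map,
          Function.Embedding.sectL_apply] at hp hp'
        obtain ⟨a, -, rfl⟩ := hp'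
        exact hp.1.2.1 rfl
    omega

/-- A lower bound for the total weight of `h + k` vertices of degree at most `h + 1`, of which at
most `2 * k - 1` have degree `h + 1`, where a vertex of degree `i` has weight `w i`. -/
def violatorWeight (w : ℕ → ℚ) (h k : ℕ) : ℚ :=
  max (((h : ℚ) - k + 1) * w h + (2 * k - 1) * w (h + 1)) ((h + k) * w (h + 1))

theorem violatorWeight_le_sum {α β : Type*} [Fintype β] (E : α → β → Prop)
    [DecidableRel E] {w : ℕ → ℚ} (hw : Antitone w) {S : Finset α} {T : Finset β} {h k : ℕ}
    (hS : #S = h + k) (hT : #T + h = Fintype.card β) (he : #{p ∈ S ×ˢ T | E p.1 p.2} + 1 ≤ 2 * k)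
    (h1 : ∀ a ∈ S, #{b ∈ T | E a b} ≤ 1) :
    violatorWeight w h k ≤ ∑ a ∈ S, w #{b | E a b} := by
  classical
  have hdeg : ∀ a, #{b | E a b} ≤ h + #{b ∈ T | E a b} := by
    intro a
    have : ({b | E a b} : Finset β) ⊆ Tᶜ ∪ {b ∈ T | E a b} := by
      intro b hb
      simp only [mem_filter, mem_univ, true_and, mem_union, mem_compl] at hb ⊢
      tauto
    have h2 := (card_le_card this).trans (card_union_le _ _)
    have h3 := card_add_card_compl T
    omega
  have hΔ : 0 ≤ w h - w (h + 1) := sub_nonneg.2 (hw (Nat.le_succ h))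
  refine max_le ?_ ?_
  · have hterm : ∀ a ∈ S, w h - #{b ∈ T | E a b} * (w h - w (h + 1)) ≤ w #{b | E a b} := by
      intro a ha
      have h2 := hdeg a
      have h3 := h1 a ha
      interval_cases hc : #{b ∈ T | E a b}
      · simpa using hw h2
      · simpa using hw h2
    have hsum : ∑ a ∈ S, #{b ∈ T | E a b} = #{p ∈ S ×ˢ T | E p.1 p.2} := by
      simp only [card_filter]
      rw [sum_product]
    have he' : (#{p ∈ S ×ˢ T | E p.1 p.2} : ℚ) ≤ 2 * k - 1 := by
      have : ((#{p ∈ S ×ˢ T | E p.1 p.2} + 1 : ℕ) : ℚ) ≤ (2 * k : ℕ) := by exact_mod_cast he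
      push_cast at this
      linarith
    calc _ = ((h + k : ℕ) : ℚ) * w h - (2 * k - 1) * (w h - w (h + 1)) := by push_cast; ring
      _ ≤ ((h + k : ℕ) : ℚ) * w h - #{p ∈ S ×ˢ T | E p.1 p.2} * (w h - w (h + 1)) := by
        gcongr
      _ = ∑ a ∈ S, (w h - #{b ∈ T | E a b} * (w h - w (h + 1))) := by
        rw [sum_sub_distrib, ← sum_mul, sum_const, nsmul_eq_mul, hS, ← hsum]
        push_cast; rfl
      _ ≤ _ := sum_le_sum hterm
  · calc _ = ∑ a ∈ S, w (h + 1) := by rw [sum_const, nsmul_eq_mul, hS]; push_cast; rfl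
      _ ≤ _ := sum_le_sum fun a ha => hw ((hdeg a).trans (by have := h1 a ha; omega))

/-- A bipartite graph whose total weight of the degrees is less than `1` satisfies the `2`-factor
criterion. -/
theorem two_factor_criterion_of_weight {α β : Type*} [Fintype α] [Fintype β] (E : α → β → Prop)
    [DecidableRel E] {w : ℕ → ℚ} (hw : Antitone w) (hw0 : ∀ i, 0 ≤ w i) {m : ℕ}
    (hα : Fintype.card α = m) (hβ : Fintype.card β = m)
    (hwt : ∀ h h' k, 1 ≤ k → h + h' + k = m →
      1 ≤ violatorWeight w h k + violatorWeight w h' k)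
    (hlt : ∑ a, w #{b | E a b} + ∑ b, w #{a | E a b} < 1) (S : Finset α) (T : Finset β) :
    2 * (#S + #T) ≤ 2 * Fintype.card α + #{p ∈ S ×ˢ T | E p.1 p.2} := by
  classical
  by_contra! hcon
  obtain ⟨S, T, hST, hS1, hT1⟩ := exists_minimal_violator E (2 * Fintype.card α) ⟨S, T, hcon⟩
  have hSm : #S ≤ m := hα ▸ card_le_univ S
  have hTm : #T ≤ m := hβ ▸ card_le_univ T
  obtain ⟨h, hh⟩ := Nat.exists_eq_add_of_le hTm
  obtain ⟨h', hh'⟩ := Nat.exists_eq_add_of_le hSm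
  obtain ⟨k, hk⟩ : ∃ k, #S + #T = m + k := Nat.exists_eq_add_of_le (by omega)
  have hswap : #{p ∈ T ×ˢ S | E p.2 p.1} = #{p ∈ S ×ˢ T | E p.1 p.2} := by
    refine card_nbij' Prod.swap Prod.swap ?_ ?_ ?_ ?_ <;> intro p <;> simp <;> tauto
  have b1 := violatorWeight_le_sum E hw (S := S) (T := T) (h := h) (k := k) (by omega) (by omega)
    (by omega) hS1
  have b2 := violatorWeight_le_sum (fun b a => E a b) hw (S := T) (T := S) (h := h') (k := k)
    (by omega) (by omega) (by omega) hT1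
  have b3 : ∑ a ∈ S, w #{b | E a b} ≤ ∑ a, w #{b | E a b} :=
    sum_le_univ_sum_of_nonneg fun _ => hw0 _
  have b4 : ∑ b ∈ T, w #{a | E a b} ≤ ∑ b, w #{a | E a b} :=
    sum_le_univ_sum_of_nonneg fun _ => hw0 _
  have := hwt h h' k (by omega) (by omega)
  linarith

/-! ### The weight function -/

/-- The weight of a vertex of degree `h` in a bipartite graph with sides of size `m`. It solves
`h * w h + w (h + 1) ≥ 1` almost optimally; the last values before `m / 2`, where both sides of a
violator contribute, depend on the parity of `m`. The value `1 / 6` matters for `m = 4` only. -/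
def degreeWeight (m h : ℕ) : ℚ :=
  if h ≤ 1 then 1 else
  if m ≤ 2 * h then (if h = 2 then 1 / 6 else 0) else
  if m = 2 * h + 1 then 1 / (2 * h) else
  if m = 2 * h + 2 then 1 / h else
  if m = 2 * h + 3 then (2 * h + 1) / (2 * h * (h + 1)) else
  (h + 1) / (h * (h + 2))

theorem degreeWeight_nonneg (m h : ℕ) : 0 ≤ degreeWeight m h := by
  unfold degreeWeight
  split_ifs <;> positivity

theorem degreeWeight_of_le_one (m : ℕ) {h : ℕ} (hh : h ≤ 1) : degreeWeight m h = 1 := by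
  simp [degreeWeight, hh]

theorem degreeWeight_of_le {m h : ℕ} (hh : 2 < h) (hm : m ≤ 2 * h) : degreeWeight m h = 0 := by
  rw [degreeWeight, if_neg (by omega), if_pos hm, if_neg (by omega)]

theorem degreeWeight_gap_one {h : ℕ} (hh : 2 ≤ h) :
    degreeWeight (2 * h + 1) h = 1 / (2 * h) := by
  rw [degreeWeight, if_neg (by omega), if_neg (by omega), if_pos rfl]

theorem degreeWeight_gap_two {h : ℕ} (hh : 1 ≤ h) : degreeWeight (2 * h + 2) h = 1 / h := by
  rcases hh.eq_or_lt with rfl | hh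
  · simp [degreeWeight]
  · rw [degreeWeight, if_neg (by omega), if_neg (by omega), if_neg (by omega), if_pos rfl]

theorem degreeWeight_gap_three {h : ℕ} (hh : 2 ≤ h) :
    degreeWeight (2 * h + 3) h = (2 * h + 1) / (2 * h * (h + 1)) := by
  rw [degreeWeight, if_neg (by omega), if_neg (by omega), if_neg (by omega), if_neg (by omega),
    if_pos rfl]

theorem degreeWeight_gap_four_le {m h : ℕ} (hh : 2 ≤ h) (hm : 2 * h + 4 ≤ m) :
    degreeWeight m h = (h + 1) / (h * (h + 2)) := by
  rw [degreeWeight, if_neg (by omega), if_neg (by omega), if_neg (by omega), if_neg (by omega),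
    if_neg (by omega)]

theorem degreeWeight_antitone (m : ℕ) : Antitone (degreeWeight m) := by
  refine antitone_nat_of_succ_le fun h => ?_
  rcases Nat.lt_or_ge h 2 with hh | hh
  · rw [degreeWeight_of_le_one m (by omega : h ≤ 1)]
    unfold degreeWeight
    have h1 : (0 : ℚ) ≤ h := by positivity
    split_ifs
    · norm_num
    · norm_num
    · norm_num
    all_goals
      rw [div_le_one (by positivity)]
      push_cast
      nlinarith
  · have h2 : (2 : ℚ) ≤ h := by exact_mod_cast hh
    have hpos : (0 : ℚ) < h := by linarith
    rcases Nat.lt_or_ge (2 * h + 2) m with hm | hm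
    · obtain ⟨g, rfl⟩ := Nat.exists_eq_add_of_lt hm
      rcases Nat.lt_or_ge g 3 with hg | hg
      · interval_cases g
        · rw [show 2 * h + 2 + 0 + 1 = 2 * (h + 1) + 1 by ring, degreeWeight_gap_one (by omega),
            show 2 * (h + 1) + 1 = 2 * h + 3 by ring, degreeWeight_gap_three hh, Nat.cast_add_one,
            div_le_div_iff₀ (by positivity) (by positivity)]
          nlinarith
        · rw [show 2 * h + 2 + 1 + 1 = 2 * (h + 1) + 2 by ring, degreeWeight_gap_two (by omega),
            degreeWeight_gap_four_le hh (by omega), Nat.cast_add_one,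
            div_le_div_iff₀ (by positivity) (by positivity)]
          nlinarith
        · rw [show 2 * h + 2 + 2 + 1 = 2 * (h + 1) + 3 by ring, degreeWeight_gap_three (by omega),
            degreeWeight_gap_four_le hh (by omega), Nat.cast_add_one,
            div_le_div_iff₀ (by positivity) (by positivity)]
          nlinarith
      · rw [degreeWeight_gap_four_le hh (by omega),
          degreeWeight_gap_four_le (by omega : 2 ≤ h + 1) (by omega), Nat.cast_add_one,
          div_le_div_iff₀ (by positivity) (by positivity)]
        nlinarith [mul_pos hpos hpos]
    · rw [degreeWeight_of_le (by omega : 2 < h + 1) (by omega)]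
      exact degreeWeight_nonneg m h

theorem le_violatorWeight_left (w : ℕ → ℚ) (h k : ℕ) :
    ((h : ℚ) - k + 1) * w h + (2 * k - 1) * w (h + 1) ≤ violatorWeight w h k := le_max_left _ _

theorem le_violatorWeight_right (w : ℕ → ℚ) (h k : ℕ) :
    (h + k) * w (h + 1) ≤ violatorWeight w h k := le_max_right _ _

theorem violatorWeight_nonneg (m h k : ℕ) : 0 ≤ violatorWeight (degreeWeight m) h k :=
  le_trans (mul_nonneg (by positivity) (degreeWeight_nonneg _ _)) (le_violatorWeight_right _ h k)

/-- Far enough from the middle, one side of a violator already has weight at least `1`. -/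
theorem one_le_violatorWeight {w : ℕ → ℚ} {h k : ℕ} (hk : 1 ≤ k) (hh : 1 ≤ h)
    (h0 : 1 / (h + 1) ≤ w h) (h1 : 1 / (h + 2) ≤ w (h + 1)) (h2 : 1 ≤ h * w h + w (h + 1)) :
    1 ≤ violatorWeight w h k := by
  have hhq : (1 : ℚ) ≤ h := by exact_mod_cast hh
  rcases hk.eq_or_lt with rfl | hk2
  · refine le_trans ?_ (le_violatorWeight_left w h 1)
    norm_num
    linarith
  have hkq : (2 : ℚ) ≤ k := by exact_mod_cast hk2
  rcases Nat.lt_or_ge (h + 1) k with hlt | hge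
  · refine le_trans ?_ (le_violatorWeight_right w h k)
    have hlt' : (h : ℚ) + 1 ≤ k := by exact_mod_cast hlt.le
    calc (1 : ℚ) ≤ (h + k) * (1 / (h + 2)) := by
          rw [mul_one_div, le_div_iff₀ (by positivity)]; linarith
      _ ≤ _ := by gcongr
  · refine le_trans ?_ (le_violatorWeight_left w h k)
    have hge' : (k : ℚ) ≤ h + 1 := by exact_mod_cast hge
    calc (1 : ℚ) ≤ (h - k + 1) * (1 / (h + 1)) + (2 * k - 1) * (1 / (h + 2)) := by
          rw [mul_one_div, mul_one_div, div_add_div _ _ (by positivity) (by positivity),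
            le_div_iff₀ (by positivity)]
          nlinarith [mul_nonneg (sub_nonneg.2 hkq) (sub_nonneg.2 hhq)]
      _ ≤ _ := by
        gcongr
        · linarith
        · linarith

/-- Write `g = m - 2 * h`, so `k ≤ g`. For `g ≥ 4` the first summand suffices; for `g ≤ 3` both are
needed, and only few values of `k` and `h'` remain. -/
theorem one_le_violatorWeight_add_of_le {m h h' k : ℕ} (hk : 1 ≤ k) (hm : h + h' + k = m)
    (hle : h ≤ h') :
    1 ≤ violatorWeight (degreeWeight m) h k + violatorWeight (degreeWeight m) h' k := by
  have hn := violatorWeight_nonneg m h' k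
  rcases Nat.eq_zero_or_pos h with rfl | hh
  · have := le_violatorWeight_right (degreeWeight m) 0 k
    rw [degreeWeight_of_le_one m (by omega)] at this
    have hkq : (1 : ℚ) ≤ k := by exact_mod_cast hk
    push_cast at this
    linarith
  have hhq : (1 : ℚ) ≤ h := by exact_mod_cast hh
  rcases Nat.lt_or_ge m (2 * h + 4) with hg | hg
  · have hk3 : k ≤ 3 := by omega
    -- For `h = 1` the weight of `h` exceeds the general formula; `m ≤ 5` then.
    rcases Nat.eq_or_lt_of_le hh with rfl | hh2
    · interval_cases k
      · have := le_violatorWeight_left (degreeWeight m) 1 1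
        rw [degreeWeight_of_le_one m le_rfl] at this
        have := degreeWeight_nonneg m 2
        norm_num at *
        linarith
      · obtain rfl | rfl : h' = 1 ∨ h' = 2 := by omega
        all_goals
          subst hm
          norm_num [violatorWeight, degreeWeight]
      · obtain rfl : h' = 1 := by omega
        subst hm
        norm_num [violatorWeight, degreeWeight]
    have b1 := le_violatorWeight_left (degreeWeight m) h k
    have b2 := le_violatorWeight_left (degreeWeight m) h' k
    have n1 := degreeWeight_nonneg m (h + 1)
    have n2 := degreeWeight_nonneg m (h' + 1)
    obtain h3 | h2 | h1 : m = 2 * h + 3 ∨ m = 2 * h + 2 ∨ m = 2 * h + 1 := by omega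
    · have e1 : degreeWeight m h = (2 * h + 1) / (2 * h * (h + 1)) := by
        rw [h3, degreeWeight_gap_three hh2]
      have e2 : degreeWeight m (h + 1) = 1 / (2 * (h + 1)) := by
        rw [h3, show 2 * h + 3 = 2 * (h + 1) + 1 by ring, degreeWeight_gap_one (by omega)]
        push_cast; rfl
      interval_cases k
      · rw [e1, e2] at b1
        refine le_trans (le_trans (le_of_eq ?_) b1) (le_add_of_nonneg_right hn)
        field_simp
        push_cast
        ring
      · obtain rfl : h' = h + 1 := by omega
        rw [e1, e2] at b1
        rw [e2] at b2
        refine le_trans ?_ (add_le_add b1 (le_trans (le_add_of_nonneg_right ?_) b2))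
        · push_cast
          rw [← sub_nonneg]
          have : (h : ℚ) * (h + 1) > 0 := by positivity
          have e : ((h : ℚ) - 2 + 1) * ((2 * h + 1) / (2 * h * (h + 1))) +
              (2 * 2 - 1) * (1 / (2 * (h + 1))) + (h + 1 - 2 + 1) * (1 / (2 * (h + 1))) - 1 =
              (h ^ 2 - 1) / (2 * h * (h + 1)) := by
            field_simp
            ring
          rw [e]
          exact div_nonneg (by nlinarith) (by positivity)
        · exact mul_nonneg (by norm_num) n2
      · obtain rfl : h' = h := by omega
        rw [e1, e2] at b1
        refine le_trans ?_ (add_le_add b1 b1)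
        rw [← sub_nonneg]
        have e : ((h' : ℚ) - (3 : ℕ) + 1) * ((2 * h' + 1) / (2 * h' * (h' + 1))) +
            (2 * (3 : ℕ) - 1) * (1 / (2 * (h' + 1))) +
            (((h' : ℚ) - (3 : ℕ) + 1) * ((2 * h' + 1) / (2 * h' * (h' + 1))) +
            (2 * (3 : ℕ) - 1) * (1 / (2 * (h' + 1)))) - 1 =
            (h' ^ 2 + h' - 2) / (h' * (h' + 1)) := by
          field_simp
          push_cast
          ring
        rw [e]
        exact div_nonneg (by nlinarith) (by positivity)
    · have e1 : degreeWeight m h = 1 / h := by rw [h2, degreeWeight_gap_two hh]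
      obtain rfl | rfl : k = 1 ∨ k = 2 := by omega
      · rw [e1] at b1
        refine le_trans (le_trans ?_ b1) (le_add_of_nonneg_right hn)
        push_cast
        rw [sub_add_cancel, mul_one_div, div_self (by positivity)]
        linarith
      · obtain rfl : h' = h := by omega
        have h2q : (2 : ℚ) ≤ h' := by exact_mod_cast hh2
        rw [e1] at b1
        refine le_trans ?_ (add_le_add b1 b1)
        have e : (1 : ℚ) ≤ 2 * ((h' - 2 + 1) * (1 / h')) := by
          rw [mul_one_div, ← mul_div_assoc, le_div_iff₀ (by positivity)]
          linarith
        push_cast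
        linarith
    · have e1 : degreeWeight m h = 1 / (2 * h) := by rw [h1, degreeWeight_gap_one hh2]
      obtain rfl : k = 1 := by omega
      obtain rfl : h' = h := by omega
      rw [e1] at b1
      have e : ((h' : ℚ) - (1 : ℕ) + 1) * (1 / (2 * h')) = 1 / 2 := by
        field_simp
        push_cast
        ring
      rw [e] at b1
      push_cast at b1
      linarith
  · refine le_trans ?_ (le_add_of_nonneg_right hn)
    have w0 : (h + 1) / (h * (h + 2)) ≤ degreeWeight m h := by
      rcases Nat.eq_or_lt_of_le hh with rfl | hh2
      · norm_num [degreeWeight]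
      · rw [degreeWeight_gap_four_le hh2 hg]
    have i0 : 1 / ((h : ℚ) + 1) ≤ (h + 1) / (h * (h + 2)) := by
      rw [div_le_div_iff₀ (by positivity) (by positivity)]
      nlinarith
    have i1 : (h + 1) / (h + 2) ≤ h * degreeWeight m h := by
      calc ((h : ℚ) + 1) / (h + 2) = h * ((h + 1) / (h * (h + 2))) := by field_simp
        _ ≤ _ := by gcongr
    suffices hs : 1 - (h + 1) / ((h : ℚ) + 2) ≤ degreeWeight m (h + 1) by
      have e : 1 / ((h : ℚ) + 2) = 1 - (h + 1) / (h + 2) := by field_simp; ring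
      exact one_le_violatorWeight hk hh (i0.trans w0) (e ▸ hs) (by linarith)
    have e : 1 - (h + 1) / ((h : ℚ) + 2) = 1 / (h + 2) := by field_simp; ring
    rw [e]
    obtain ⟨g, rfl⟩ := Nat.exists_eq_add_of_le hg
    rcases Nat.lt_or_ge g 2 with hg2 | hg2
    · interval_cases g
      · rw [show 2 * h + 4 + 0 = 2 * (h + 1) + 2 by ring, degreeWeight_gap_two (by omega),
          Nat.cast_add_one]
        gcongr
        norm_num
      · rw [show 2 * h + 4 + 1 = 2 * (h + 1) + 3 by ring, degreeWeight_gap_three (by omega),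
          Nat.cast_add_one, div_le_div_iff₀ (by positivity) (by positivity)]
        nlinarith
    · rw [degreeWeight_gap_four_le (by omega) (by omega), Nat.cast_add_one,
        div_le_div_iff₀ (by positivity) (by positivity)]
      nlinarith

theorem one_le_violatorWeight_add {m h h' k : ℕ} (hk : 1 ≤ k) (hm : h + h' + k = m) :
    1 ≤ violatorWeight (degreeWeight m) h k + violatorWeight (degreeWeight m) h' k := by
  rcases le_total h h' with hle | hle
  · exact one_le_violatorWeight_add_of_le hk hm hle
  · rw [add_comm]
    exact one_le_violatorWeight_add_of_le hk (by omega) hle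

/-! ### Averaging over the halves of the vertex set -/

/-- The number of `r`-subsets `Z` of `U` for which `N ∩ Z` has `h` elements. -/
theorem card_powersetCard_filter_card_inter {V : Type*} [DecidableEq V] {U N : Finset V}
    (hN : N ⊆ U) {r h : ℕ} (hh : h ≤ r) :
    #{Z ∈ U.powersetCard r | #(N ∩ Z) = h} = (#N).choose h * (#U - #N).choose (r - h) := by
  rw [← card_sdiff_of_subset hN, ← card_powersetCard, ← card_powersetCard, ← card_product]
  have hcard : ∀ Z ⊆ U, #(N ∩ Z) + #(Z \ N) = #Z := fun Z _ => by
    rw [inter_comm]; exact card_inter_add_card_sdiff Z N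
  refine card_nbij' (fun Z => (N ∩ Z, Z \ N)) (fun p => p.1 ∪ p.2) ?_ ?_ ?_ ?_
  · intro Z hZ
    simp only [coe_filter, mem_powersetCard, Set.mem_ofPred_eq] at hZ
    have := hcard Z hZ.1.1
    simp only [coe_product, Set.mem_prod, mem_coe, mem_powersetCard]
    exact ⟨⟨inter_subset_left, hZ.2⟩, sdiff_subset_sdiff hZ.1.1 le_rfl, by omega⟩
  · rintro ⟨A, B⟩ hp
    simp only [coe_product, Set.mem_prod, mem_coe, mem_powersetCard] at hp
    obtain ⟨⟨hA, hAc⟩, hB, hBc⟩ := hp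
    have hd : Disjoint N B := disjoint_of_subset_right hB disjoint_sdiff
    simp only [coe_filter, mem_powersetCard, Set.mem_ofPred_eq]
    refine ⟨⟨union_subset (hA.trans hN) (hB.trans sdiff_subset), ?_⟩, ?_⟩
    · rw [card_union_of_disjoint (disjoint_of_subset_left hA hd)]
      omega
    · rw [inter_union_distrib_left, inter_eq_right.2 hA, disjoint_iff_inter_eq_empty.1 hd,
        union_empty, hAc]
  · intro Z _
    ext x
    simp only [mem_union, mem_inter, mem_sdiff]
    tauto
  · rintro ⟨A, B⟩ hp
    simp only [coe_product, Set.mem_prod, mem_coe, mem_powersetCard] at hp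
    obtain ⟨⟨hA, hAc⟩, hB, hBc⟩ := hp
    have hd : Disjoint N B := disjoint_of_subset_right hB disjoint_sdiff
    simp only [Prod.mk.injEq]
    constructor
    · rw [inter_union_distrib_left, inter_eq_right.2 hA, disjoint_iff_inter_eq_empty.1 hd,
        union_empty]
    · rw [union_sdiff_distrib, sdiff_eq_empty_iff_subset.2 hA, empty_union,
        sdiff_eq_self_of_disjoint hd.symm]

/-- `(s + e).choose r` times the expectation of `w` under the hypergeometric law that counts the
marked elements in a random `r`-subset of a set with `s` marked and `e` unmarked elements. -/
def hypergeometricSum (w : ℕ → ℚ) (s e r : ℕ) : ℚ :=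
  ∑ h ∈ range (r + 1), s.choose h * e.choose (r - h) * w h

theorem sum_powersetCard_card_inter {V : Type*} [DecidableEq V] {U N : Finset V} (hN : N ⊆ U)
    (r : ℕ) (w : ℕ → ℚ) :
    ∑ Z ∈ U.powersetCard r, w #(N ∩ Z) = hypergeometricSum w #N (#U - #N) r := by
  rw [hypergeometricSum, ← sum_fiberwise_of_maps_to (t := range (r + 1)) (g := fun Z => #(N ∩ Z))]
  · refine sum_congr rfl fun h hh => ?_
    rw [sum_congr rfl (g := fun _ => w h) (fun Z hZ => by rw [(mem_filter.1 hZ).2]), sum_const,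
      nsmul_eq_mul,
      card_powersetCard_filter_card_inter hN (Nat.lt_succ_iff.1 (mem_range.1 hh))]
    push_cast
    rfl
  · intro Z hZ
    rw [mem_range, Nat.lt_succ_iff, ← (mem_powersetCard.1 hZ).2]
    exact card_le_card inter_subset_right

theorem sum_powersetCard_card_inter_le {V : Type*} [DecidableEq V] {U N : Finset V} (hN : N ⊆ U)
    {d : ℕ} (hd : d ≤ #N) (r : ℕ) {w : ℕ → ℚ} (hw : Antitone w) :
    ∑ Z ∈ U.powersetCard r, w #(N ∩ Z) ≤ hypergeometricSum w d (#U - d) r := by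
  obtain ⟨N', hN', rfl⟩ := exists_subset_card_eq hd
  rw [← sum_powersetCard_card_inter (hN'.trans hN)]
  exact sum_le_sum fun Z _ => hw (card_le_card (inter_subset_inter_right hN'))

/-- First moment argument: some half `X` of the vertices has small total weight, when each vertex
is weighted by its number of arcs between `X` and its complement that leave `X`. -/
theorem exists_half_weight_lt_one {V : Type*} [Fintype V] [DecidableEq V] (R : V → V → Prop)
    [DecidableRel R] (hR : ∀ v, ¬ R v v) {m d : ℕ} (hm : 1 ≤ m) (hV : Fintype.card V = 2 * m)
    (hout : ∀ v, d ≤ #{u | R v u}) (hin : ∀ v, d ≤ #{u | R u v}) {w : ℕ → ℚ} (hw : Antitone w)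
    (hsum : 2 * m * hypergeometricSum w d (2 * m - 1 - d) m < (2 * m - 1).choose m) :
    ∃ X : Finset V, #X = m ∧
      ∑ x ∈ X, w #{y ∈ Xᶜ | R x y} + ∑ y ∈ Xᶜ, w #{x ∈ X | R x y} < 1 := by
  by_contra! hcon
  have hU : ∀ v : V, #(univ.erase v) = 2 * m - 1 := fun v => by
    rw [card_erase_of_mem (mem_univ v), card_univ, hV]
  have hcount : (2 * m).choose m = 2 * (2 * m - 1).choose m := by
    obtain ⟨k, rfl⟩ := Nat.exists_eq_add_of_le' hm
    rw [show 2 * (k + 1) - 1 = 2 * k + 1 by omega, show 2 * (k + 1) = (2 * k + 1) + 1 by ring,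
      Nat.choose_succ_succ, Nat.choose_symm_of_eq_add (by omega : 2 * k + 1 = k + (k + 1))]
    ring
  have hlow : ((2 * m).choose m : ℚ) ≤ ∑ X ∈ (univ : Finset V).powersetCard m,
      (∑ x ∈ X, w #{y ∈ Xᶜ | R x y} + ∑ y ∈ Xᶜ, w #{x ∈ X | R x y}) := by
    rw [← hV, ← card_univ, ← card_powersetCard, ← nsmul_one]
    exact card_nsmul_le_sum _ _ _ fun X hX => hcon X (mem_powersetCard.1 hX).2
  have hsplit : ∀ X : Finset V,
      ∑ x ∈ X, w #{y ∈ Xᶜ | R x y} + ∑ y ∈ Xᶜ, w #{x ∈ X | R x y} =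
      ∑ v, ((if v ∈ X then w #{y ∈ Xᶜ | R v y} else 0) +
        if v ∉ X then w #{x ∈ X | R x v} else 0) := by
    intro X
    rw [sum_add_distrib, ← sum_filter, ← sum_filter]
    congr 2
    · ext; simp
    · ext; simp
  have hv1 : ∀ v : V, ∑ X ∈ (univ : Finset V).powersetCard m,
      (if v ∈ X then w #{y ∈ Xᶜ | R v y} else 0) ≤ hypergeometricSum w d (2 * m - 1 - d) m := by
    intro v
    have hN : ({u | R v u} : Finset V) ⊆ univ.erase v := by
      intro u hu
      rw [mem_erase]
      refine ⟨?_, mem_univ u⟩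
      rintro rfl
      exact hR u (mem_filter.1 hu).2
    have := sum_powersetCard_card_inter_le hN (hout v) m hw
    rw [hU] at this
    rw [← sum_filter]
    refine le_trans (le_of_eq ?_) this
    refine sum_nbij' (fun X => Xᶜ) (fun X => Xᶜ) ?_ ?_ ?_ ?_ ?_
    · intro X hX
      simp only [mem_filter, mem_powersetCard, subset_univ, true_and] at hX
      rw [mem_powersetCard, card_compl, hX.1, hV]
      refine ⟨fun u hu => ?_, by omega⟩
      rw [mem_erase]
      refine ⟨?_, mem_univ u⟩
      rintro rfl
      exact (mem_compl.1 hu) hX.2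
    · intro Z hZ
      rw [mem_powersetCard] at hZ
      simp only [mem_filter, mem_powersetCard, subset_univ, true_and, card_compl, hV, mem_compl]
      refine ⟨by omega, fun hvZ => ?_⟩
      exact (mem_erase.1 (hZ.1 hvZ)).1 rfl
    · intro X _; exact compl_compl X
    · intro X _; exact compl_compl X
    · intro X _
      congr 2
      ext u
      simp only [mem_filter, mem_inter, mem_univ, true_and]
      tauto
  have hv2 : ∀ v : V, ∑ X ∈ (univ : Finset V).powersetCard m,
      (if v ∉ X then w #{x ∈ X | R x v} else 0) ≤ hypergeometricSum w d (2 * m - 1 - d) m := by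
    intro v
    have hN : ({u | R u v} : Finset V) ⊆ univ.erase v := by
      intro u hu
      rw [mem_erase]
      refine ⟨?_, mem_univ u⟩
      rintro rfl
      exact hR u (mem_filter.1 hu).2
    have := sum_powersetCard_card_inter_le hN (hin v) m hw
    rw [hU] at this
    rw [← sum_filter]
    refine le_trans (le_of_eq ?_) this
    refine sum_congr ?_ ?_
    · ext X
      simp only [mem_filter, mem_powersetCard, subset_univ, true_and, subset_erase]
      tauto
    · intro X _
      congr 2
      ext u
      simp only [mem_filter, mem_inter, mem_univ, true_and]
      tauto
  have hup : ∑ X ∈ (univ : Finset V).powersetCard m,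
      (∑ x ∈ X, w #{y ∈ Xᶜ | R x y} + ∑ y ∈ Xᶜ, w #{x ∈ X | R x y}) ≤
      2 * m * (2 * hypergeometricSum w d (2 * m - 1 - d) m) := by
    rw [sum_congr rfl fun X _ => hsplit X, sum_comm]
    calc _ ≤ ∑ v : V, 2 * hypergeometricSum w d (2 * m - 1 - d) m := by
          refine sum_le_sum fun v _ => ?_
          rw [sum_add_distrib, two_mul]
          exact add_le_add (hv1 v) (hv2 v)
      _ = _ := by
          rw [sum_const, card_univ, hV, nsmul_eq_mul]
          push_cast
          ring
  rw [hcount] at hlow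
  push_cast at hlow
  linarith

namespace Digraph

/-- Reduction of the existence of an anti-directed `2`-factor to an inequality between binomial
coefficients. -/
theorem hasAntidirectedTwoFactor_of_hypergeometricSum_lt {V : Type*} [Fintype V] (D : Digraph V)
    (hD : D.Loopless) {m d : ℕ} (hm : 1 ≤ m) (hV : Fintype.card V = 2 * m)
    (hout : ∀ v, d ≤ D.outDeg v) (hin : ∀ v, d ≤ D.inDeg v)
    (hsum : 2 * m * hypergeometricSum (degreeWeight m) d (2 * m - 1 - d) m <
      (2 * m - 1).choose m) : D.HasAntidirectedTwoFactor := by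
  classical
  obtain ⟨X, hX, hlt⟩ := exists_half_weight_lt_one D.Adj hD hm hV
    (fun v => (hout v).trans_eq (by
      rw [outDeg, Set.ncard_eq_toFinset_card']; congr 1; ext; simp))
    (fun v => (hin v).trans_eq (by
      rw [inDeg, Set.ncard_eq_toFinset_card']; congr 1; ext; simp))
    (degreeWeight_antitone m) hsum
  let E : X → (Xᶜ : Finset V) → Prop := fun a b => D.Adj a b
  have hα : Fintype.card X = m := by simp [hX]
  have hβ : Fintype.card (Xᶜ : Finset V) = m := by
    rw [Fintype.card_coe, card_compl, hX, hV]; omega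
  have hdeg₁ : ∀ a : X, #{b | E a b} = #{y ∈ Xᶜ | D.Adj a y} := by
    intro a
    rw [← card_map (Function.Embedding.subtype _)]
    congr 1
    ext y
    simp [E, and_comm]
  have hdeg₂ : ∀ b : (Xᶜ : Finset V), #{a | E a b} = #{x ∈ X | D.Adj x b} := by
    intro b
    rw [← card_map (Function.Embedding.subtype _)]
    congr 1
    ext y
    simp [E, and_comm]
  have hcrit := two_factor_criterion_of_weight E (degreeWeight_antitone m)
    (degreeWeight_nonneg m) hα hβ (fun h h' k hk hm => one_le_violatorWeight_add hk hm) (by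
      simp only [hdeg₁, hdeg₂]
      rw [sum_coe_sort X fun x => degreeWeight m #{y ∈ Xᶜ | D.Adj x y},
        sum_coe_sort Xᶜ fun y => degreeWeight m #{x ∈ X | D.Adj x y}]
      exact hlt)
  obtain ⟨F, hFE, hF₁, hF₂⟩ := exists_two_regular_subgraph E (hα.trans hβ.symm) hcrit
  obtain ⟨f, g, hfg⟩ := exists_disjoint_matchings_of_two_regular F hF₁ hF₂
  -- Follow `f` from `X` to its complement and `g` back.
  let nx : V → V := fun v => if h : v ∈ X then f ⟨v, h⟩ else g.symm ⟨v, mem_compl.2 h⟩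
  have nx_pos : ∀ v (h : v ∈ X), nx v = f ⟨v, h⟩ := fun v h => dif_pos h
  have nx_neg : ∀ v (h : v ∉ X), nx v = g.symm ⟨v, mem_compl.2 h⟩ := fun v h => dif_neg h
  have nx_mem : ∀ v, nx v ∈ X ↔ v ∉ X := by
    intro v
    by_cases h : v ∈ X
    · rw [nx_pos v h]
      simp [h, mem_compl.1 (f ⟨v, h⟩).2]
    · rw [nx_neg v h]
      simp [h]
  have nx_inj : Function.Injective nx := by
    intro u v huv
    have hmem : u ∉ X ↔ v ∉ X := by rw [← nx_mem, ← nx_mem, huv]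
    by_cases hu : u ∈ X
    · have hv : v ∈ X := by tauto
      rw [nx_pos u hu, nx_pos v hv] at huv
      simpa using f.injective (Subtype.ext huv)
    · have hv : v ∉ X := by tauto
      rw [nx_neg u hu, nx_neg v hv] at huv
      simpa using g.symm.injective (Subtype.ext huv)
  refine hasAntidirectedTwoFactor_of_perm (X : Set V)
    (Equiv.ofBijective nx (Finite.injective_iff_bijective.1 nx_inj)) ?_ ?_ ?_
  · intro v hv
    rw [mem_coe] at hv
    refine ⟨fun h => (nx_mem v).1 h hv, ?_⟩
    simp only [Equiv.ofBijective_apply]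
    rw [nx_pos v hv]
    exact hFE _ _ (hfg ⟨v, hv⟩).1
  · intro v hv
    rw [mem_coe] at hv
    refine ⟨(nx_mem v).2 hv, ?_⟩
    simp only [Equiv.ofBijective_apply]
    rw [nx_neg v hv]
    have := hFE _ _ (hfg (g.symm ⟨v, mem_compl.2 hv⟩)).2.1
    rwa [Equiv.apply_symm_apply] at this
  · intro v hv
    simp only [Equiv.ofBijective_apply] at hv
    by_cases h : v ∈ X
    · have h' : nx v ∉ X := fun hc => (nx_mem v).1 hc h
      rw [nx_neg _ h'] at hv
      have e : g.symm ⟨nx v, mem_compl.2 h'⟩ = ⟨v, h⟩ := Subtype.ext hv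
      rw [Equiv.symm_apply_eq] at e
      refine (hfg ⟨v, h⟩).2.2 (e ▸ Subtype.ext ?_)
      exact (nx_pos v h).symm
    · have h' : nx v ∈ X := (nx_mem v).2 h
      rw [nx_pos _ h'] at hv
      have e : (⟨nx v, h'⟩ : X) = g.symm ⟨v, mem_compl.2 h⟩ := Subtype.ext (nx_neg v h)
      refine (hfg (g.symm ⟨v, mem_compl.2 h⟩)).2.2 ?_
      rw [Equiv.apply_symm_apply, ← e]
      exact Subtype.ext hv

end Digraph

/-! ### Hypergeometric tails: finitely many sizes -/

/-- The number of `m`-subsets of a set with `m + 1 + q` marked and `m - 2 - q` unmarked elements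
that contain exactly `h` marked elements. -/
def splitCount (m q h : ℕ) : ℕ := (m + 1 + q).choose h * (m - 2 - q).choose (m - h)

/-- The ratio of consecutive terms. For `h ≤ q + 1` the truncated `h - 1 - q` correctly gives `0`. -/
theorem splitCount_mul {m q h : ℕ} (hh : h < m) :
    splitCount m q h * ((m + 1 + q - h) * (m - h)) =
      splitCount m q (h + 1) * ((h + 1) * (h - 1 - q)) := by
  have e1 := Nat.choose_succ_right_eq (m + 1 + q) h
  have e2 := Nat.choose_succ_right_eq (m - 2 - q) (m - (h + 1))
  rw [show m - (h + 1) + 1 = m - h by omega, show m - 2 - q - (m - (h + 1)) = h - 1 - q by omega]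
    at e2
  calc splitCount m q h * ((m + 1 + q - h) * (m - h))
      = ((m + 1 + q).choose h * (m + 1 + q - h)) * ((m - 2 - q).choose (m - h) * (m - h)) := by
        rw [splitCount]; ring
    _ = _ := by rw [← e1, e2, splitCount]; ring

theorem splitCount_of_le_one {m q h : ℕ} (hm : 2 ≤ m) (hh : h ≤ 1) : splitCount m q h = 0 := by
  rw [splitCount, Nat.choose_eq_zero_of_lt (by omega : m - 2 - q < m - h), mul_zero]

theorem sum_splitCount {m q : ℕ} (hq : q + 2 ≤ m) :
    ∑ h ∈ range (m + 1), splitCount m q h = (2 * m - 1).choose m := by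
  rw [show 2 * m - 1 = (m + 1 + q) + (m - 2 - q) by omega, Nat.add_choose_eq,
    Nat.sum_antidiagonal_eq_sum_range_succ_mk]
  rfl

theorem splitCount_self_pos (m q : ℕ) : 0 < splitCount m q m := by
  rw [splitCount, Nat.sub_self, Nat.choose_zero_right, mul_one]
  exact Nat.choose_pos (by omega)

/-- The weight vanishes from the middle on, so the sum may be stopped there. -/
theorem hypergeometricSum_degreeWeight {m q : ℕ} (hm : 5 ≤ m) :
    hypergeometricSum (degreeWeight m) (m + 1 + q) (m - 2 - q) m =
      ∑ h ∈ range ((m - 1) / 2 + 1), (splitCount m q h : ℚ) * degreeWeight m h := by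
  symm
  rw [hypergeometricSum]
  refine (sum_subset (range_subset_range.2 (by omega)) fun h _ hh => ?_).trans
    (sum_congr rfl fun h _ => ?_)
  · rw [mem_range, not_lt] at hh
    rw [degreeWeight_of_le (by omega) (by omega), mul_zero]
  · rw [splitCount]
    push_cast
    rfl

/-- An upper bound for `10 ^ 9 * degreeWeight m h` in integer arithmetic, for `2 ≤ h` and
`2 * h < m`. The cases are tested by `Nat.ble`, most frequent first, for fast kernel evaluation. -/
def scaledWeight (m h : ℕ) : ℕ :=
  bif Nat.ble (2 * h + 4) m then 10 ^ 9 * (h + 1) / (h * (h + 2)) + 1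
  else bif Nat.ble (2 * h + 3) m then 10 ^ 9 * (2 * h + 1) / (2 * h * (h + 1)) + 1
  else bif Nat.ble (2 * h + 2) m then 10 ^ 9 / h + 1
  else bif Nat.ble (2 * h + 1) m then 10 ^ 9 / (2 * h) + 1 else 0

theorem div_le_nat_div_add_one (a b : ℕ) : (a : ℚ) / b ≤ (a / b + 1 : ℕ) := by
  have := Nat.lt_floor_add_one ((a : ℚ) / b)
  rw [Nat.floor_div_eq_div] at this
  push_cast
  exact this.le

theorem degreeWeight_le_scaledWeight {m h : ℕ} (hh : 2 ≤ h) (hm : 2 * h + 1 ≤ m) :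
    10 ^ 9 * degreeWeight m h ≤ scaledWeight m h := by
  simp only [scaledWeight, Bool.cond_eq_ite, Nat.ble_eq]
  rcases Nat.lt_or_ge m (2 * h + 4) with hlt | hge
  · rw [if_neg (by omega)]
    obtain rfl | rfl | rfl : m = 2 * h + 1 ∨ m = 2 * h + 2 ∨ m = 2 * h + 3 := by omega
    · rw [if_neg (by omega),
        if_neg (by omega), if_pos le_rfl,
        degreeWeight_gap_one hh]
      refine le_trans (le_of_eq ?_) (div_le_nat_div_add_one _ _)
      push_cast
      ring
    · rw [if_neg (by omega), if_pos le_rfl, degreeWeight_gap_two (by omega)]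
      refine le_trans (le_of_eq ?_) (div_le_nat_div_add_one _ _)
      push_cast
      ring
    · rw [if_pos le_rfl, degreeWeight_gap_three hh]
      refine le_trans (le_of_eq ?_) (div_le_nat_div_add_one _ _)
      push_cast
      ring
  · rw [if_pos hge, degreeWeight_gap_four_le hh hge]
    refine le_trans (le_of_eq ?_) (div_le_nat_div_add_one _ _)
    push_cast
    ring

/-- Horner evaluation, rounded up, of
`∑ i ≤ h, (2 * m * 10 ^ 9 * degreeWeight m i - 10 ^ 9) * splitCount m q i`
divided by `splitCount m q h`. Truncated subtraction only increases the value. -/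
def lowerTail (m q : ℕ) : ℕ → ℕ
  | 0 => 0
  | h + 1 => (2 * m * scaledWeight m (h + 1) - 10 ^ 9) +
      (lowerTail m q h * ((h + 1) * (h - 1 - q)) / ((m + 1 + q - h) * (m - h)) + 1)

/-- Horner evaluation, rounded down, of `10 ^ 9 * ∑ h ∈ Ioc (top - i) top, a h` divided by
`a (top - i)`, for a sequence with `a h * den h = a (h + 1) * num h`. If only `≤` holds, it is
still a lower bound; a vanishing `num` does no harm, because division by `0` gives `0`. -/
def upperTail (num den : ℕ → ℕ) (top : ℕ) : ℕ → ℕ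
  | 0 => 0
  | i + 1 => (10 ^ 9 + upperTail num den top i) * den (top - (i + 1)) / num (top - (i + 1))

theorem sum_le_lowerTail_mul {m q h : ℕ} (hq : q + 2 ≤ m) (hh : 2 * h + 1 ≤ m) :
    ∑ i ∈ range (h + 1), (2 * m * (10 ^ 9 * degreeWeight m i) - 10 ^ 9) * splitCount m q i ≤
      (lowerTail m q h : ℚ) * splitCount m q h := by
  induction h with
  | zero => simp [splitCount_of_le_one (q := q) (by omega : 2 ≤ m) zero_le_one]
  | succ h ih =>
    rw [sum_range_succ, lowerTail]
    have ih' := ih (by omega)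
    have hden : (0 : ℚ) < ((m + 1 + q - h) * (m - h) : ℕ) := by
      have h1 : 0 < m + 1 + q - h := by omega
      have h2 : 0 < m - h := by omega
      exact_mod_cast Nat.mul_pos h1 h2
    have hrec : (splitCount m q h : ℚ) * ((m + 1 + q - h) * (m - h) : ℕ) =
        splitCount m q (h + 1) * ((h + 1) * (h - 1 - q) : ℕ) := by
      exact_mod_cast splitCount_mul (by omega)
    have b1 : (lowerTail m q h : ℚ) * splitCount m q h ≤
        (lowerTail m q h * ((h + 1) * (h - 1 - q)) / ((m + 1 + q - h) * (m - h)) + 1 : ℕ) *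
          splitCount m q (h + 1) := by
      refine le_trans (le_of_eq ?_)
        (mul_le_mul_of_nonneg_right (div_le_nat_div_add_one _ _) (by positivity))
      rw [div_mul_eq_mul_div, eq_div_iff hden.ne', mul_assoc, hrec]
      push_cast
      ring
    have b2 : (2 * m * (10 ^ 9 * degreeWeight m (h + 1)) - 10 ^ 9) * splitCount m q (h + 1) ≤
        ((2 * m * scaledWeight m (h + 1) - 10 ^ 9 : ℕ) : ℚ) * splitCount m q (h + 1) := by
      rcases Nat.eq_zero_or_pos h with rfl | hpos
      · rw [splitCount_of_le_one (by omega) (by omega), Nat.cast_zero, mul_zero, mul_zero]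
      · refine mul_le_mul_of_nonneg_right ?_ (by positivity)
        have h1 := degreeWeight_le_scaledWeight (by omega : 2 ≤ h + 1) hh
        have h2 : ((2 * m * scaledWeight m (h + 1) : ℕ) : ℚ) ≤
            ((2 * m * scaledWeight m (h + 1) - 10 ^ 9 : ℕ) : ℚ) + 10 ^ 9 := by
          exact_mod_cast le_tsub_add
        push_cast at h2
        have h3 : 2 * (m : ℚ) * (10 ^ 9 * degreeWeight m (h + 1)) ≤
          2 * m * scaledWeight m (h + 1) := mul_le_mul_of_nonneg_left h1 (by positivity)
        push_cast
        linarith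
    rw [Nat.cast_add, add_mul, add_comm]
    exact add_le_add b2 (ih'.trans b1)

theorem upperTail_mul_le {a num den : ℕ → ℕ} {top i : ℕ}
    (ha : ∀ h < top, a h * den h ≤ a (h + 1) * num h) (hi : i ≤ top) :
    upperTail num den top i * a (top - i) ≤ 10 ^ 9 * ∑ h ∈ Ioc (top - i) top, a h := by
  induction i with
  | zero => simp [upperTail]
  | succ i ih =>
    have ih' := ih (by omega)
    obtain ⟨g, hg⟩ : ∃ g, top - (i + 1) = g := ⟨_, rfl⟩
    have hg' : top - i = g + 1 := by omega
    rw [hg'] at ih'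
    rw [upperTail, hg]
    have hsum : ∑ h ∈ Ioc g top, a h = a (g + 1) + ∑ h ∈ Ioc (g + 1) top, a h := by
      rw [← sum_Ioc_consecutive a (Nat.le_succ g) (by omega : g + 1 ≤ top)]
      simp
    rw [hsum]
    have b : (10 ^ 9 + upperTail num den top i) * den g / num g * a g ≤
        (10 ^ 9 + upperTail num den top i) * a (g + 1) := by
      rcases Nat.eq_zero_or_pos (num g) with h0 | hpos
      · simp [h0]
      · refine Nat.le_of_mul_le_mul_right ?_ hpos
        calc _ = (10 ^ 9 + upperTail num den top i) * den g / num g * num g * a g := by ring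
          _ ≤ (10 ^ 9 + upperTail num den top i) * den g * a g :=
            Nat.mul_le_mul_right _ (Nat.div_mul_le_self _ _)
          _ = (10 ^ 9 + upperTail num den top i) * (a g * den g) := by ring
          _ ≤ (10 ^ 9 + upperTail num den top i) * (a (g + 1) * num g) :=
            Nat.mul_le_mul_left _ (ha g (by omega))
          _ = _ := by ring
    calc _ ≤ _ := b
      _ = 10 ^ 9 * a (g + 1) + upperTail num den top i * a (g + 1) := by ring
      _ ≤ _ := by rw [mul_add]; exact Nat.add_le_add_left ih' _

/-- The comparison of the two tails for a given `m`. Below the middle each term counts with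
`2 * m` times its weight, minus the `1` that it contributes to the total number of subsets; above
the middle the weight is `0`, and at most `40` terms of the total are taken into account. -/
def tailCheck (m : ℕ) : Bool :=
  Nat.blt (lowerTail m (m / 23) ((m - 1) / 2))
    (upperTail (fun h => (h + 1) * (h - 1 - m / 23)) (fun h => (m + 1 + m / 23 - h) * (m - h))
      ((m - 1) / 2 + min (m / 2 + 1) 40) (min (m / 2 + 1) 40))

theorem hypergeometricSum_lt_of_tailCheck {m : ℕ} (hm : 5 ≤ m) (hc : tailCheck m = true) :
    2 * m * hypergeometricSum (degreeWeight m) (m + 1 + m / 23) (m - 2 - m / 23) m <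
      (2 * m - 1).choose m := by
  have hq : m / 23 + 2 ≤ m := by omega
  rw [tailCheck] at hc
  generalize hj : min (m / 2 + 1) 40 = j at hc
  generalize hcdef : (m - 1) / 2 = c at hc
  have hlt : lowerTail m (m / 23) c < _ := Nat.le_of_ble_eq_true hc
  have hlow := sum_le_lowerTail_mul hq (by omega : 2 * c + 1 ≤ m)
  have hup := upperTail_mul_le (a := splitCount m (m / 23)) (top := c + j) (i := j)
    (fun h hh => (splitCount_mul (by omega)).le) (by omega)
  rw [Nat.add_sub_cancel] at hup
  have hsplit : ∑ h ∈ range (c + 1), splitCount m (m / 23) h + ∑ h ∈ Ioc c m,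
      splitCount m (m / 23) h = (2 * m - 1).choose m := by
    rw [← sum_splitCount hq, range_eq_Ico, range_eq_Ico, ← Ico_succ_succ_eq_Ioc]
    exact sum_Ico_consecutive _ (Nat.zero_le _) (by simp; omega)
  have hpos : 0 < ∑ h ∈ Ioc c m, splitCount m (m / 23) h :=
    sum_pos' (fun _ _ => Nat.zero_le _) ⟨m, by rw [mem_Ioc]; omega, splitCount_self_pos _ _⟩
  have hup' := hup.trans (Nat.mul_le_mul_left (10 ^ 9) (sum_le_sum_of_subset
    (Ioc_subset_Ioc_right (by omega : c + j ≤ m))))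
  have hstrict : lowerTail m (m / 23) c * splitCount m (m / 23) c <
      10 ^ 9 * ∑ h ∈ Ioc c m, splitCount m (m / 23) h := by
    rcases Nat.eq_zero_or_pos (splitCount m (m / 23) c) with h0 | h0
    · rw [h0, mul_zero]
      positivity
    · exact (Nat.mul_lt_mul_of_pos_right hlt h0).trans_le hup'
  have hfin : ((lowerTail m (m / 23) c * splitCount m (m / 23) c : ℕ) : ℚ) <
      (10 ^ 9 * ∑ h ∈ Ioc c m, splitCount m (m / 23) h : ℕ) := by exact_mod_cast hstrict
  have hsplit' : ((∑ h ∈ range (c + 1), splitCount m (m / 23) h : ℕ) : ℚ) +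
      (∑ h ∈ Ioc c m, splitCount m (m / 23) h : ℕ) = ((2 * m - 1).choose m : ℕ) := by
    exact_mod_cast hsplit
  rw [hypergeometricSum_degreeWeight hm, hcdef, ← hsplit']
  have e : ∑ i ∈ range (c + 1), (2 * m * (10 ^ 9 * degreeWeight m i) - 10 ^ 9) *
      (splitCount m (m / 23) i : ℚ) = 10 ^ 9 * (2 * m * ∑ i ∈ range (c + 1),
        (splitCount m (m / 23) i : ℚ) * degreeWeight m i -
        (∑ h ∈ range (c + 1), splitCount m (m / 23) h : ℕ)) := by
    push_cast
    rw [mul_sum, ← sum_sub_distrib, mul_sum]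
    exact sum_congr rfl fun i _ => by ring
  rw [e] at hlow
  push_cast at hlow hfin ⊢
  linarith

/-- `tailCheck m` for all `m` from `5` to `k + 4`. -/
def tailCheckUpTo : ℕ → Bool
  | 0 => true
  | i + 1 => tailCheck (i + 5) && tailCheckUpTo i

theorem tailCheck_of_tailCheckUpTo {k : ℕ} (hk : tailCheckUpTo k = true) {i : ℕ} (hi : i < k) :
    tailCheck (i + 5) = true := by
  induction k with
  | zero => omega
  | succ k ih =>
    rw [tailCheckUpTo, Bool.and_eq_true] at hk
    rcases Nat.lt_succ_iff_lt_or_eq.1 hi with h | rfl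
    · exact ih hk.2 h
    · exact hk.1

set_option maxRecDepth 10000 in
theorem tailCheckUpTo_363 : tailCheckUpTo 363 = true := by decide +kernel

theorem hypergeometricSum_lt_of_lt {m : ℕ} (hm : 5 ≤ m) (hm' : m < 368) :
    2 * m * hypergeometricSum (degreeWeight m) (m + 1 + m / 23) (m - 2 - m / 23) m <
      (2 * m - 1).choose m := by
  obtain ⟨i, rfl⟩ := Nat.exists_eq_add_of_le' hm
  exact hypergeometricSum_lt_of_tailCheck hm
    (tailCheck_of_tailCheckUpTo tailCheckUpTo_363 (by omega))

/-! ### Hypergeometric tails: large sizes -/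

/-- Below the middle, consecutive terms of the hypergeometric distribution, divided by `h`, grow at
least by the factor `25 / 21`, so that their sum is dominated by a geometric series. -/
theorem sum_splitCount_div_le {m h : ℕ} (hh : 1 ≤ h) (hm : 2 * h ≤ m) :
    ∑ i ∈ Icc 1 h, (splitCount m (m / 23) i : ℚ) / i ≤
      25 / 4 * (splitCount m (m / 23) h / h) := by
  induction h, hh using Nat.le_induction with
  | base => simp [splitCount_of_le_one (by omega : 2 ≤ m) le_rfl]
  | succ h hh ih =>
    rw [sum_Icc_succ_top (by omega)]
    have ih' := ih (by omega)
    have hstep : 25 * (splitCount m (m / 23) h * (h + 1)) ≤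
        21 * (splitCount m (m / 23) (h + 1) * h) := by
      have hden : 0 < (m + 1 + m / 23 - h) * (m - h) := Nat.mul_pos (by omega) (by omega)
      refine Nat.le_of_mul_le_mul_right ?_ hden
      have hnum : 25 * ((h + 1) * ((h + 1) * (h - 1 - m / 23))) ≤
          21 * (h * ((m + 1 + m / 23 - h) * (m - h))) := by
        have h1 : (h + 1) * (h - 1 - m / 23) ≤ h * (h - m / 23) := by
          rcases Nat.lt_or_ge h (m / 23 + 1) with hlt | hge
          · rw [show h - 1 - m / 23 = 0 by omega]; simp
          · obtain ⟨y, hy⟩ := Nat.exists_eq_add_of_le hge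
            rw [show h - 1 - m / 23 = y by omega, show h - m / 23 = y + 1 by omega, add_mul, mul_add]
            omega
        have h2 : 25 * (h - m / 23) ≤ 21 * (m + 1 + m / 23 - h) := by omega
        calc 25 * ((h + 1) * ((h + 1) * (h - 1 - m / 23)))
            ≤ 25 * ((h + 1) * (h * (h - m / 23))) := by gcongr
          _ = h * ((25 * (h - m / 23)) * (h + 1)) := by ring
          _ ≤ h * ((21 * (m + 1 + m / 23 - h)) * (m - h)) := by
            gcongr
            omega
          _ = _ := by ring
      calc _ = 25 * (h + 1) * (splitCount m (m / 23) h * ((m + 1 + m / 23 - h) * (m - h))) := by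
            ring
        _ = 25 * ((h + 1) * ((h + 1) * (h - 1 - m / 23))) * splitCount m (m / 23) (h + 1) := by
            rw [splitCount_mul (by omega)]; ring
        _ ≤ 21 * (h * ((m + 1 + m / 23 - h) * (m - h))) * splitCount m (m / 23) (h + 1) :=
            Nat.mul_le_mul_right _ hnum
        _ = _ := by ring
    have hstep' : 25 * ((splitCount m (m / 23) h : ℚ) * (h + 1)) ≤
        21 * (splitCount m (m / 23) (h + 1) * h) := by exact_mod_cast hstep
    have hhq : (0 : ℚ) < h := by exact_mod_cast hh
    have hdiv : 25 * ((splitCount m (m / 23) h : ℚ) / h) ≤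
        21 * (splitCount m (m / 23) (h + 1) / (h + 1 : ℕ)) := by
      rw [← mul_div_assoc, ← mul_div_assoc, div_le_div_iff₀ hhq (by positivity)]
      push_cast
      linarith
    linarith

theorem degreeWeight_le_one_div {m h : ℕ} (hh : 1 ≤ h) (hm : 2 * h + 1 ≤ m) :
    degreeWeight m h ≤ 1 / h := by
  have hpos : (1 : ℚ) ≤ h := by exact_mod_cast hh
  rcases Nat.eq_or_lt_of_le hh with rfl | hh2
  · simp [degreeWeight]
  rcases Nat.lt_or_ge m (2 * h + 4) with hlt | hge
  · obtain rfl | rfl | rfl : m = 2 * h + 1 ∨ m = 2 * h + 2 ∨ m = 2 * h + 3 := by omega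
    · rw [degreeWeight_gap_one hh2, div_le_div_iff₀ (by positivity) (by positivity)]
      linarith
    · rw [degreeWeight_gap_two hh]
    · rw [degreeWeight_gap_three hh2, div_le_div_iff₀ (by positivity) (by positivity)]
      nlinarith
  · rw [degreeWeight_gap_four_le hh2 hge, div_le_div_iff₀ (by positivity) (by positivity)]
    nlinarith

/-- Lower bound for the ratios of consecutive terms just above the middle, uniformly in `m`. -/
theorem splitCount_mul_le_splitCount_mul {m i : ℕ} (hm : 368 ≤ m) (hi : i < 30) :
    splitCount m (m / 23) ((m - 1) / 2 + i) * ((199 - i) * (183 - i)) ≤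
      splitCount m (m / 23) ((m - 1) / 2 + (i + 1)) * ((185 + i) * (169 + i)) := by
  generalize hc : (m - 1) / 2 = c
  have hden : 0 < (m + 1 + m / 23 - (c + i)) * (m - (c + i)) := Nat.mul_pos (by omega) (by omega)
  have hmi : 368 * (i + 1) ≤ m * (i + 1) := Nat.mul_le_mul_right _ hm
  refine Nat.le_of_mul_le_mul_right ?_ hden
  have n1 : 368 * (c + i + 1) ≤ m * (185 + i) := by
    rw [show m * (185 + i) = 184 * m + m * (i + 1) by ring]; omega
  have n2 : 368 * (c + i - 1 - m / 23) ≤ m * (169 + i) := by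
    rw [show m * (169 + i) = 168 * m + m * (i + 1) by ring]; omega
  have n3 : m * (199 - i) ≤ 368 * (m + 1 + m / 23 - (c + i)) := by
    have : m * (199 - i) + m * (i + 1) = 200 * m := by
      rw [← mul_add, show 199 - i + (i + 1) = 200 by omega, mul_comm]
    omega
  have n4 : m * (183 - i) ≤ 368 * (m - (c + i)) := by
    have : m * (183 - i) + m * (i + 1) = 184 * m := by
      rw [← mul_add, show 183 - i + (i + 1) = 184 by omega, mul_comm]
    omega
  have hnum : ((c + i + 1) * (c + i - 1 - m / 23)) * ((199 - i) * (183 - i)) ≤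
      ((185 + i) * (169 + i)) * ((m + 1 + m / 23 - (c + i)) * (m - (c + i))) := by
    have hpos : 0 < 368 * 368 * (m * m) := by positivity
    refine Nat.le_of_mul_le_mul_right ?_ hpos
    calc _ = (368 * (c + i + 1)) * (368 * (c + i - 1 - m / 23)) *
          ((m * (199 - i)) * (m * (183 - i))) := by ring
      _ ≤ (m * (185 + i)) * (m * (169 + i)) * ((368 * (m + 1 + m / 23 - (c + i))) *
          (368 * (m - (c + i)))) := by gcongr
      _ = _ := by ring
  calc _ = (splitCount m (m / 23) (c + i) * ((m + 1 + m / 23 - (c + i)) * (m - (c + i)))) *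
        ((199 - i) * (183 - i)) := by ring
    _ = splitCount m (m / 23) (c + (i + 1)) *
        (((c + i + 1) * (c + i - 1 - m / 23)) * ((199 - i) * (183 - i))) := by
      rw [splitCount_mul (by omega), add_assoc c i 1]; ring
    _ ≤ splitCount m (m / 23) (c + (i + 1)) *
        (((185 + i) * (169 + i)) * ((m + 1 + m / 23 - (c + i)) * (m - (c + i)))) :=
      Nat.mul_le_mul_left _ hnum
    _ = _ := by ring

theorem two_mul_mul_lt_of_tail_bound {m c A S T : ℚ} (hm : 0 ≤ m) (hc : 183 ≤ c)
    (hmc : m ≤ 2 * c + 2) (hA : 0 ≤ A) (hS : S ≤ 25 / 4 * (A / c)) (hT : 26 * A ≤ T)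
    (hpos : 0 < T) : 2 * m * S < T := by
  have hc0 : 0 < c := by linarith
  calc 2 * m * S ≤ 2 * m * (25 / 4 * (A / c)) := mul_le_mul_of_nonneg_left hS (by positivity)
    _ = 25 / 2 * (m / c) * A := by ring
    _ ≤ 25 / 2 * (2 + 2 / 183) * A := by
      gcongr
      rw [div_le_iff₀ hc0]
      linarith
    _ < _ := by linarith

theorem hypergeometricSum_lt_of_ge {m : ℕ} (hm : 368 ≤ m) :
    2 * m * hypergeometricSum (degreeWeight m) (m + 1 + m / 23) (m - 2 - m / 23) m <
      (2 * m - 1).choose m := by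
  have hq : m / 23 + 2 ≤ m := by omega
  have hup := upperTail_mul_le (a := fun i => splitCount m (m / 23) ((m - 1) / 2 + i))
    (num := fun i => (185 + i) * (169 + i)) (den := fun i => (199 - i) * (183 - i))
    (top := 25) (i := 25)
    (fun h hh => splitCount_mul_le_splitCount_mul hm (by omega)) le_rfl
  have hnum : 25 * 10 ^ 9 ≤ upperTail (fun i => (185 + i) * (169 + i))
    (fun i => (199 - i) * (183 - i)) 25 25 := by decide +kernel
  generalize upperTail (fun i => (185 + i) * (169 + i))
    (fun i => (199 - i) * (183 - i)) 25 25 = U at hup hnum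
  rw [hypergeometricSum_degreeWeight (by omega)]
  generalize hc : (m - 1) / 2 = c at hup ⊢
  rw [Nat.sub_self, add_zero] at hup
  have hlow : ∑ h ∈ range (c + 1), (splitCount m (m / 23) h : ℚ) * degreeWeight m h ≤
      25 / 4 * (splitCount m (m / 23) c / c) := by
    refine le_trans ?_ (sum_splitCount_div_le (by omega) (by omega))
    rw [range_eq_Ico, sum_eq_sum_Ico_succ_bot (by omega), splitCount_of_le_one (by omega)
      zero_le_one, Nat.cast_zero, zero_mul, zero_add,
      show Ico (0 + 1) (c + 1) = Icc 1 c by ext; simp only [mem_Ico, mem_Icc]; omega]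
    refine sum_le_sum fun h hh => ?_
    rw [mem_Icc] at hh
    have hw : degreeWeight m h ≤ 1 / h := degreeWeight_le_one_div (by omega) (by omega)
    calc (splitCount m (m / 23) h : ℚ) * degreeWeight m h
        ≤ splitCount m (m / 23) h * (1 / h) := mul_le_mul_of_nonneg_left hw (Nat.cast_nonneg _)
      _ = _ := mul_one_div _ _
  have hsub : splitCount m (m / 23) c + ∑ i ∈ Ioc 0 25, splitCount m (m / 23) (c + i) ≤
      (2 * m - 1).choose m := by
    rw [← sum_splitCount hq]
    have e : ∑ i ∈ Ioc 0 25, splitCount m (m / 23) (c + i) =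
        ∑ h ∈ Ioc c (c + 25), splitCount m (m / 23) h := by
      have := sum_map (Ioc 0 25) (addLeftEmbedding c) (splitCount m (m / 23))
      rw [map_add_left_Ioc, add_zero] at this
      exact this.symm
    rw [e, ← sum_insert (f := splitCount m (m / 23)) (a := c) (by simp)]
    refine sum_le_sum_of_subset fun h hh => ?_
    rw [mem_insert, mem_Ioc] at hh
    rw [mem_range]
    omega
  have htot : 26 * splitCount m (m / 23) c ≤ (2 * m - 1).choose m := by
    have h1 := (Nat.mul_le_mul_right (splitCount m (m / 23) c) hnum).trans hup
    rw [mul_comm 25, mul_assoc] at h1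
    have h2 := Nat.le_of_mul_le_mul_left h1 (Nat.pow_pos (by norm_num))
    omega
  have hpos : 0 < (2 * m - 1).choose m := Nat.choose_pos (by omega)
  have hc183 : (183 : ℚ) ≤ c := by
    have : 183 ≤ c := by omega
    exact_mod_cast this
  have hmc : (m : ℚ) ≤ 2 * c + 2 := by
    have : m ≤ 2 * c + 2 := by omega
    exact_mod_cast this
  have htot' : 26 * (splitCount m (m / 23) c : ℚ) ≤ ((2 * m - 1).choose m : ℕ) := by
    exact_mod_cast htot
  have hpos' : (0 : ℚ) < ((2 * m - 1).choose m : ℕ) := by exact_mod_cast hpos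
  have hA : (0 : ℚ) ≤ splitCount m (m / 23) c := Nat.cast_nonneg _
  generalize (splitCount m (m / 23) c : ℚ) = A at hlow htot' hA
  exact two_mul_mul_lt_of_tail_bound (Nat.cast_nonneg m) hc183 hmc hA hlow htot' hpos'

/-- The inequality behind the constant `24 / 46`. -/
theorem hypergeometricSum_degreeWeight_lt {m : ℕ} (hm : 2 ≤ m) :
    2 * m * hypergeometricSum (degreeWeight m) (m + 1 + m / 23) (2 * m - 1 - (m + 1 + m / 23)) m <
      (2 * m - 1).choose m := by
  rw [show 2 * m - 1 - (m + 1 + m / 23) = m - 2 - m / 23 by omega]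
  rcases Nat.lt_or_ge m 5 with h5 | h5
  · interval_cases m <;>
      norm_num [hypergeometricSum, sum_range_succ, degreeWeight, Nat.choose]
  rcases Nat.lt_or_ge m 368 with h | h
  · exact hypergeometricSum_lt_of_lt h5 h
  · exact hypergeometricSum_lt_of_ge h

theorem corollary2 {V : Type*} [Fintype V] (D : Digraph V) (hD : D.Loopless)
    (heven : Even (Fintype.card V))
    (hdeg : (24 / 46 : ℝ) * (Fintype.card V : ℝ) < (D.minSemidegree : ℝ)) :
    D.HasAntidirectedTwoFactor := by
  classical
  obtain ⟨m, hm⟩ := heven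
  have hV : Fintype.card V = 2 * m := by omega
  have hδ : 24 * m < 23 * D.minSemidegree := by
    rw [hV] at hdeg
    push_cast at hdeg
    have : (24 * m : ℝ) < 23 * D.minSemidegree := by linarith
    exact_mod_cast this
  have hmin : ∀ v, D.minSemidegree ≤ min (D.outDeg v) (D.inDeg v) := fun v =>
    ciInf_le (OrderBot.bddBelow _) v
  have hd : m + 1 + m / 23 ≤ D.minSemidegree := by omega
  have hout : ∀ v, m + 1 + m / 23 ≤ D.outDeg v := fun v =>
    (hd.trans (hmin v)).trans (min_le_left _ _)
  have hin : ∀ v, m + 1 + m / 23 ≤ D.inDeg v := fun v =>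
    (hd.trans (hmin v)).trans (min_le_right _ _)
  have hm2 : 2 ≤ m := by
    have hne : Nonempty V := by
      by_contra hempty
      rw [not_nonempty_iff] at hempty
      -- The infimum over the empty type is `0`.
      have : D.minSemidegree = 0 := by rw [Digraph.minSemidegree, Nat.iInf_of_empty]
      omega
    obtain ⟨v⟩ := hne
    have hlt : D.outDeg v < Fintype.card V := by
      rw [Digraph.outDeg, ← Nat.card_eq_fintype_card]
      exact Set.ncard_lt_card fun h => hD v (h ▸ Set.mem_univ v : v ∈ {w | D.Adj v w})
    have := hout v
    omega
  exact D.hasAntidirectedTwoFactor_of_hypergeometricSum_lt hD (by omega) hV hout hin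
    (hypergeometricSum_degreeWeight_lt hm2)
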